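/- Let $\mathbb{H}$ be the real algebra of quaternions, $\mathbb{S}=\{I\in\mathbb{H}: I^2=-1\}$, $L_I=\mathbb{R}+\mathbb{R}I$ for $I\in\mathbb{S}$, and let $\widehat{\mathbb{H}}=\mathbb{H}\cup\{\infty\}$ be the one-point compactification. For a function $f$ on $\mathbb{H}$ let $f_I=f|_{L_I}$; where it takes finite values, $f_I$ is called holomorphic if it is real differentiable and $\frac12\left(\frac{\partial}{\partial x}+I\frac{\partial}{\partial y}\right)f_I(x+yI)=0$. A function $f:\mathbb{H}\to\widehat{\mathbb{H}}$ is \emph{semiregular} if for every $I\in\mathbb{S}$ the restriction $f_I$ is meromorphic: each $p\in L_I$ either has a neighbourhood in $L_I$ on which $f_I$ is finite and holomorphic, or satisfies $f(p)=\infty$ and has a punctured disc in $L_I$ around it on which $f_I$ is finite, holomorphic and equal to a Laurent series $f_I(z)=\sum_{k\in\mathbb{Z}}(z-p)^k a_k$, $a_k\in\mathbb{H}$, with only finitely many nonzero coefficients of negative index. For convergent power series $f(q)=\sum_n q^n a_n$, $g(q)=\sum_n q^n b_n$ put $(f*g)(q)=\sum_n q^n\sum_{k=0}^n a_k b_{n-k}$,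 $f^c(q)=\sum_n q^n\overline{a_n}$, $f^s=f*f^c$, and $(f^{-*}*g)(q)=f^s(q)^{-1}\,(f^c*g)(q)$ wherever $f^s(q)\neq0$. For $A=\begin{pmatrix}a&c\\ b&d\end{pmatrix}\in GL(2,\mathbb{H})$ the \emph{regular fractional transformation} associated to $A$ is $\mathcal{F}_A(q)=(qc+d)^{-*}*(qa+b)$. \textbf{Theorem.} Let $f:\widehat{\mathbb{H}}\to\widehat{\mathbb{H}}$ be continuous and injective, and let $f|_{\mathbb{H}}$ be semiregular. Then one of the following holds. (1) $f$ is a regular affine transformation: there are $a,b\in\mathbb{H}$ with $a\neq0$ such that $f(q)=qa+b$ for all $q\in\mathbb{H}$, and $f(\infty)=\infty$. (2) $f$ is a regular fractional transformation with its pole at a real point: there are $x\in\mathbb{R}$ and $a,b\in\mathbb{H}$ with $a\neq0$ such that the matrix $\begin{pmatrix}b&1\\ a-xb&-x\end{pmatrix}$ is invertible, $f(x)=\infty$, $f(\infty)=b$, and every $q\in\mathbb{H}\setminus\{x\}$ lies in the domain of definition of the associated regular fractional transformation, with $$f(q)=(q-x)^{-*}*(qb+a-xb).$$ -/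

import Mathlib

open scoped Quaternion

noncomputable section

namespace SliceRegular

/-- The one-point (Alexandroff) compactification `ℍ ∪ {∞}` of the quaternions. -/
abbrev HHat : Type := OnePoint ℍ[ℝ]

/-- The 2-sphere `𝕊` of quaternionic imaginary units. -/
def imaginaryUnits : Set ℍ[ℝ] := {I | I ^ 2 = -1}

/-- The parametrization `x + i y ↦ x + y I` of the complex line `L_I = ℝ + ℝ I`. -/
def slice (I : ℍ[ℝ]) (z : ℂ) : ℍ[ℝ] := (z.re : ℍ[ℝ]) + (z.im : ℍ[ℝ]) * I

/-- The operator `½ (∂/∂x + I ∂/∂y)`, applied to a function `g` of `x + y I ∈ L_I`,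
written in the coordinate `x + i y ∈ ℂ`. -/
def dbar (I : ℍ[ℝ]) (g : ℂ → ℍ[ℝ]) (z : ℂ) : ℍ[ℝ] :=
  (1 / 2 : ℝ) • (fderiv ℝ g z 1 + I * fderiv ℝ g z Complex.I)

/-- `f_I` takes finite values on the open subset `U` of `L_I ≅ ℂ`, where it is real
differentiable and holomorphic, i.e. `½ (∂/∂x + I ∂/∂y) f_I = 0`. The function `g` is `f_I`, seen
as `ℍ`-valued on `U`. -/
def IsRegularOnSlice (I : ℍ[ℝ]) (f : ℍ[ℝ] → HHat) (g : ℂ → ℍ[ℝ]) (U : Set ℂ) : Prop :=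
  (∀ z ∈ U, f (slice I z) = ((g z : ℍ[ℝ]) : HHat)) ∧
    DifferentiableOn ℝ g U ∧ ∀ z ∈ U, dbar I g z = 0

/-- The point `p` of `L_I` is a non-essential isolated singularity of `f_I`: on a punctured disc
around `p`, `f_I` is finite and regular, and it has a Laurent expansion `∑ (z - p)^k a_k` in which
`a_{-m} = 0` for all sufficiently large `m` (a pole, of order `0` if removable). -/
def IsPoleOnSlice (I : ℍ[ℝ]) (f : ℍ[ℝ] → HHat) (p : ℂ) : Prop :=
  ∃ R : ℝ, 0 < R ∧ ∃ g : ℂ → ℍ[ℝ],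
    IsRegularOnSlice I f g (Metric.ball p R \ {p}) ∧
    ∃ a : ℤ → ℍ[ℝ], (∃ n : ℕ, ∀ m : ℕ, n < m → a (-(m : ℤ)) = 0) ∧
      ∀ z ∈ Metric.ball p R \ {p},
        HasSum (fun k : ℤ => (slice I z - slice I p) ^ k * a k) (g z)

/-- `f : ℍ → ℍ ∪ {∞}` is semiregular on `ℍ`: for every imaginary unit `I`, the restriction `f_I`
is meromorphic, i.e. each point of `L_I` either has a neighbourhood in `L_I` on which `f_I` is
finite and regular, or is a point with value `∞` that is not an essential singularity. -/
def IsSemiregular (f : ℍ[ℝ] → HHat) : Prop :=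
  ∀ I ∈ imaginaryUnits, ∀ p : ℂ,
    (∃ R : ℝ, 0 < R ∧ ∃ g : ℂ → ℍ[ℝ], IsRegularOnSlice I f g (Metric.ball p R)) ∨
      (f (slice I p) = OnePoint.infty ∧ IsPoleOnSlice I f p)

/-- The value `∑ qⁿ aₙ` at `q` of the power series with coefficients `aₙ`. Regular functions on
`ℍ` are identified with everywhere convergent power series; multiplication of formal power
series over `ℍ` (with central variable) is then the regular product `*`. -/
def value (F : PowerSeries ℍ[ℝ]) (q : ℍ[ℝ]) : ℍ[ℝ] :=
  ∑' n : ℕ, q ^ n * PowerSeries.coeff n F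

/-- The regular conjugate `f^c(q) = ∑ qⁿ conj(aₙ)`. -/
def conj (F : PowerSeries ℍ[ℝ]) : PowerSeries ℍ[ℝ] :=
  PowerSeries.mk fun n => star (PowerSeries.coeff n F)

/-- The symmetrization `f^s = f * f^c`. -/
def symmetrization (F : PowerSeries ℍ[ℝ]) : PowerSeries ℍ[ℝ] := F * conj F

/-- The domain of definition of the regular quotients `f^{-*} * g`: the complement of the
zero set of `f^s`. -/
def quotientDomain (F : PowerSeries ℍ[ℝ]) : Set ℍ[ℝ] := {q | value (symmetrization F) q ≠ 0}

/-- The left regular quotient `(f^{-*} * g)(q) = f^s(q)⁻¹ (f^c * g)(q)`, meaningful for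
`q ∈ quotientDomain F`. -/
def regularQuotient (F G : PowerSeries ℍ[ℝ]) (q : ℍ[ℝ]) : ℍ[ℝ] :=
  (value (symmetrization F) q)⁻¹ * value (conj F * G) q

/-- The regular function `q ↦ q c + d`. -/
def linear (c d : ℍ[ℝ]) : PowerSeries ℍ[ℝ] :=
  PowerSeries.X * PowerSeries.C c + PowerSeries.C d

/-- The domain of definition in `ℍ` of the regular fractional transformation of
`A = (a c; b d)`. -/
def fractionalDomain (A : (Matrix (Fin 2) (Fin 2) ℍ[ℝ])ˣ) : Set ℍ[ℝ] :=
  quotientDomain (linear (A.val 0 1) (A.val 1 1))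

/-- The regular fractional transformation `𝓕_A(q) = (q c + d)^{-*} * (q a + b)` of
`A = (a c; b d) ∈ GL(2, ℍ)`. -/
def regularFractional (A : (Matrix (Fin 2) (Fin 2) ℍ[ℝ])ˣ) (q : ℍ[ℝ]) : ℍ[ℝ] :=
  regularQuotient (linear (A.val 0 1) (A.val 1 1)) (linear (A.val 0 0) (A.val 1 0)) q

/-- `f` is the regular affine transformation `q ↦ q a + b` with `a ≠ 0`, extended by `∞ ↦ ∞`. -/
def IsRegularAffine (f : HHat → HHat) : Prop :=
  f OnePoint.infty = OnePoint.infty ∧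
    ∃ a b : ℍ[ℝ], a ≠ 0 ∧ ∀ q : ℍ[ℝ], f (q : HHat) = ((q * a + b : ℍ[ℝ]) : HHat)

end SliceRegular

end

/-!
Suppose first that `f ∞ = ∞`. Then `f` restricts to an everywhere convergent power series on `ℍ`
that is injective and tends to infinity, and `F q = f q - f 0` vanishes only at the origin.
Factoring out the largest power, `F q = q ^ k * G q`, where `G` has no zeros and `‖q‖ ^ k * ‖G q‖`
tends to infinity. The symmetrization of `G` has real coefficients, so on every slice it is the same
entire function `φ` of a complex variable, and `‖φ‖` at `q` is `‖G q‖ * ‖G p‖` for some `p` with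
`‖p‖ = ‖q‖`. Hence `φ` has no zeros and `φ⁻¹` has polynomial growth, so `φ` is constant. It follows
that `‖G q‖ = ‖φ‖ / ‖G p‖` has polynomial growth, so `G` is a polynomial, and it is bounded on the
real axis, where `‖φ‖ = ‖G‖ ^ 2`; hence `G` is constant. Thus `f q = q ^ k * b + f 0`, and
injectivity on a slice, tested on roots of unity, gives `k = 1`.

If `f ∞` is finite, Liouville's theorem produces a pole on each slice. By injectivity all slices
share a single pole, which therefore is a real point `x`. The function `q ↦ f (q⁻¹ + x)` fixes `∞`
and is holomorphic on slices away from the origin, where the singularity is removable by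
continuity; so it is affine by the first case.
-/

noncomputable section

namespace SliceRegular

open Filter Topology Bornology Asymptotics
open Finset.HasAntidiagonal
  (antidiagonal mem_antidiagonal sigmaAntidiagonalEquivProd sigmaAntidiagonalEquivProd_apply)
open OnePoint (infty)
open PowerSeries (coeff C X)

section PowerSeriesExpansion

variable {𝕜 E : Type*} [NontriviallyNormedField 𝕜] [NormedAddCommGroup E] [NormedSpace 𝕜 E]
  {a b : ℕ → E} {u : 𝕜 → E}

theorem hasFPowerSeriesOnBall_of_hasSum_pow_smul
    (ha : ∀ x, HasSum (fun n => x ^ n • a n) (u x)) :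
    HasFPowerSeriesOnBall u (fun n => ContinuousMultilinearMap.mkPiRing 𝕜 (Fin n) (a n)) 0 ⊤ where
  r_le := by
    refine ENNReal.le_of_forall_nnreal_lt fun r _ => ?_
    obtain ⟨x, hx⟩ := NormedField.exists_lt_norm 𝕜 r
    obtain ⟨C, hC⟩ := (ha x).summable.tendsto_atTop_zero.norm.bddAbove_range
    refine FormalMultilinearSeries.le_radius_of_bound _ C fun n => ?_
    calc ‖ContinuousMultilinearMap.mkPiRing 𝕜 (Fin n) (a n)‖ * (r : ℝ) ^ n
        ≤ ‖a n‖ * ‖x‖ ^ n := by rw [ContinuousMultilinearMap.norm_mkPiRing]; gcongr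
      _ = ‖x ^ n • a n‖ := by rw [norm_smul, norm_pow, mul_comm]
      _ ≤ C := hC ⟨n, rfl⟩
  r_pos := ENNReal.zero_lt_top
  hasSum := fun {x} _ => by simpa using ha x

theorem eq_of_hasSum_pow_smul (ha : ∀ x, HasSum (fun n => x ^ n • a n) (u x))
    (hb : ∀ x, HasSum (fun n => x ^ n • b n) (u x)) : a = b := by
  have hu := (hasFPowerSeriesOnBall_of_hasSum_pow_smul ha).hasFPowerSeriesAt
  have hab := hu.eq_formalMultilinearSeries
    (hasFPowerSeriesOnBall_of_hasSum_pow_smul hb).hasFPowerSeriesAt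
  funext n
  exact ContinuousMultilinearMap.mkPiRing_eq_iff.1 (congrFun hab n)

theorem differentiable_of_hasSum_pow_smul [CompleteSpace E]
    (ha : ∀ x, HasSum (fun n => x ^ n • a n) (u x)) : Differentiable 𝕜 u := fun x =>
  (hasFPowerSeriesOnBall_of_hasSum_pow_smul ha).differentiableOn.differentiableAt
    (Metric.isOpen_eball.mem_nhds (by simp))

end PowerSeriesExpansion

section Entire

variable {E : Type*} [NormedAddCommGroup E] [NormedSpace ℂ E] [CompleteSpace E]

theorem hasSum_pow_smul_iteratedDeriv {u : ℂ → E} (hu : Differentiable ℂ u) (z : ℂ) :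
    HasSum (fun n => z ^ n • ((n.factorial : ℂ)⁻¹ • iteratedDeriv n u 0)) (u z) :=
  (Complex.hasSum_taylorSeries_of_entire hu 0 z).congr_fun fun n => by rw [sub_zero, smul_comm]

theorem iteratedDeriv_eq_zero_of_isBigO_pow {u : ℂ → E} (hu : Differentiable ℂ u) {m n : ℕ}
    (hO : u =O[cobounded ℂ] (· ^ m)) (hmn : m < n) : iteratedDeriv n u 0 = 0 := by
  obtain ⟨C, hC⟩ := hO.bound
  obtain ⟨R, -, hR⟩ := hasBasis_cobounded_norm.eventually_iff.1 hC
  have cauchy_estimate :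
      ∀ᶠ ρ : ℝ in atTop, ‖iteratedDeriv n u 0‖ ≤ n.factorial * C / ρ ^ (n - m) := by
    filter_upwards [eventually_ge_atTop R, eventually_gt_atTop 0] with ρ hρR hρ
    calc ‖iteratedDeriv n u 0‖ ≤ n.factorial * (C * ρ ^ m) / ρ ^ n := by
          refine Complex.norm_iteratedDeriv_le_of_forall_mem_sphere_norm_le n hρ
            hu.diffContOnCl fun z hz => ?_
          rw [mem_sphere_zero_iff_norm] at hz
          simpa [hz] using hR (hz.symm ▸ hρR : R ≤ ‖z‖)
      _ = n.factorial * C / ρ ^ (n - m) := by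
          rw [← mul_assoc, ← Nat.sub_add_cancel hmn.le, pow_add, Nat.sub_add_cancel hmn.le,
            mul_div_mul_right _ _ (pow_pos hρ m).ne']
  have hlim : Tendsto (fun ρ : ℝ => n.factorial * C / ρ ^ (n - m)) atTop (𝓝 0) :=
    tendsto_const_nhds.div_atTop (tendsto_pow_atTop (Nat.sub_pos_of_lt hmn).ne')
  exact norm_le_zero_iff.1 (ge_of_tendsto hlim cauchy_estimate)

theorem coeff_eq_zero_of_isBigO_pow {a : ℕ → E} {u : ℂ → E}
    (ha : ∀ z, HasSum (fun n => z ^ n • a n) (u z)) {m n : ℕ}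
    (hO : u =O[cobounded ℂ] (· ^ m)) (hmn : m < n) : a n = 0 := by
  have hu := differentiable_of_hasSum_pow_smul ha
  have htaylor := congrFun (eq_of_hasSum_pow_smul ha (hasSum_pow_smul_iteratedDeriv hu)) n
  rw [htaylor, iteratedDeriv_eq_zero_of_isBigO_pow hu hO hmn, smul_zero]

theorem exists_polynomial_of_isBigO_pow {u : ℂ → ℂ} (hu : Differentiable ℂ u) {m : ℕ}
    (hO : u =O[cobounded ℂ] (· ^ m)) : ∃ P : Polynomial ℂ, ∀ z, u z = P.eval z := by
  refine ⟨∑ n ∈ Finset.range (m + 1),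
    Polynomial.monomial n ((n.factorial : ℂ)⁻¹ • iteratedDeriv n u 0), fun z => ?_⟩
  have hvanish : ∀ n ∉ Finset.range (m + 1),
      z ^ n • ((n.factorial : ℂ)⁻¹ • iteratedDeriv n u 0) = 0 := fun n hn => by
    rw [iteratedDeriv_eq_zero_of_isBigO_pow hu hO (by simpa using hn), smul_zero, smul_zero]
  rw [(hasSum_pow_smul_iteratedDeriv hu z).unique (hasSum_sum_of_ne_finset_zero hvanish),
    Polynomial.eval_finsetSum]
  exact Finset.sum_congr rfl fun n _ => by rw [Polynomial.eval_monomial, smul_eq_mul, mul_comm]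

theorem exists_eq_const_of_isBigO_pow_of_ne_zero {u : ℂ → ℂ} (hu : Differentiable ℂ u) {m : ℕ}
    (hO : u =O[cobounded ℂ] (· ^ m)) (hne : ∀ z, u z ≠ 0) : ∃ c, ∀ z, u z = c := by
  obtain ⟨P, hP⟩ := exists_polynomial_of_isBigO_pow hu hO
  have hdeg : P.degree ≤ 0 := by
    by_contra! h
    obtain ⟨z, hz⟩ := Complex.exists_root h
    exact hne z ((hP z).trans hz)
  exact ⟨P.coeff 0, fun z => by
    rw [hP, Polynomial.eq_C_of_degree_le_zero hdeg, Polynomial.eval_C, Polynomial.coeff_C_zero]⟩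

end Entire

section CauchyProduct

variable {A : Type*} [NormedRing A] [NormOneClass A] [CompleteSpace A]

theorem hasSum_pow_mul_sum_antidiagonal {a b : ℕ → A} {q s t : A}
    (ha : Summable fun n => ‖q‖ ^ n * ‖a n‖) (hb : Summable fun n => ‖q‖ ^ n * ‖b n‖)
    (hs : HasSum (fun n => q ^ n * a n) s) (ht : HasSum (fun n => q ^ n * (s * b n)) t) :
    HasSum (fun n => q ^ n * ∑ kl ∈ antidiagonal n, a kl.1 * b kl.2) t := by
  have hprod : Summable fun kl : ℕ × ℕ => q ^ (kl.1 + kl.2) * (a kl.1 * b kl.2) := by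
    refine .of_norm_bounded (ha.mul_of_nonneg hb (fun _ => by positivity) fun _ => by positivity)
      fun kl => ?_
    calc ‖q ^ (kl.1 + kl.2) * (a kl.1 * b kl.2)‖
        ≤ ‖q‖ ^ (kl.1 + kl.2) * (‖a kl.1‖ * ‖b kl.2‖) :=
          (norm_mul_le _ _).trans <| by gcongr <;> [exact norm_pow_le _ _; exact norm_mul_le _ _]
      _ = ‖q‖ ^ kl.1 * ‖a kl.1‖ * (‖q‖ ^ kl.2 * ‖b kl.2‖) := by ring
  have hcols : ∀ l, HasSum (fun k => q ^ (k + l) * (a k * b l)) (q ^ l * (s * b l)) := fun l =>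
    ((hs.mul_right (b l)).mul_left (q ^ l)).congr_fun fun k => by
      rw [add_comm, pow_add, mul_assoc, mul_assoc]
  have htotal : ∑' kl : ℕ × ℕ, q ^ (kl.1 + kl.2) * (a kl.1 * b kl.2) = t :=
    (((Equiv.prodComm ℕ ℕ).hasSum_iff.2 hprod.hasSum).prod_fiberwise hcols).unique ht
  rw [← htotal]
  refine ((sigmaAntidiagonalEquivProd.hasSum_iff.2 hprod.hasSum).sigma fun n =>
    hasSum_fintype _).congr_fun fun n => ?_
  rw [Finset.mul_sum, ← Finset.sum_coe_sort]
  exact Finset.sum_congr rfl fun kl _ => by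
    simp only [Function.comp_apply, sigmaAntidiagonalEquivProd_apply, mem_antidiagonal.1 kl.2]

end CauchyProduct

section EntirePowerSeries

variable {F G : PowerSeries ℍ[ℝ]}

/-- `F` converges on all of `ℍ`, so that `value F` is a regular function on `ℍ`. -/
def IsEntire (F : PowerSeries ℍ[ℝ]) : Prop :=
  ∀ q : ℍ[ℝ], Summable fun n => q ^ n * coeff n F

theorem IsEntire.hasSum_value (hF : IsEntire F) (q : ℍ[ℝ]) :
    HasSum (fun n => q ^ n * coeff n F) (value F q) :=
  (hF q).hasSum

theorem isEntire_iff_summable_norm :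
    IsEntire F ↔ ∀ r : ℝ, Summable fun n => r ^ n * ‖coeff n F‖ := by
  refine ⟨fun hF r => .of_norm ?_, fun hF q => .of_norm ?_⟩
  · simpa only [norm_mul, norm_pow, Quaternion.norm_coe, norm_norm] using (hF r).norm
  · simpa only [norm_mul, norm_pow] using hF ‖q‖

protected theorem IsEntire.conj (hF : IsEntire F) : IsEntire (conj F) := by
  rw [isEntire_iff_summable_norm] at hF ⊢
  simpa only [conj, PowerSeries.coeff_mk, norm_star] using hF

theorem IsEntire.C_mul (hF : IsEntire F) (c : ℍ[ℝ]) : IsEntire (C c * F) := by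
  rw [isEntire_iff_summable_norm] at hF ⊢
  simpa only [PowerSeries.coeff_C_mul, norm_mul, mul_left_comm _ ‖c‖] using
    fun r => (hF r).mul_left ‖c‖

theorem IsEntire.hasSum_mul (hF : IsEntire F) (hG : IsEntire G) (q : ℍ[ℝ]) :
    HasSum (fun n => q ^ n * coeff n (F * G)) (value (C (value F q) * G) q) := by
  have hscaled := (hG.C_mul (value F q)).hasSum_value q
  simp only [PowerSeries.coeff_C_mul] at hscaled
  exact (hasSum_pow_mul_sum_antidiagonal (isEntire_iff_summable_norm.1 hF ‖q‖)
    (isEntire_iff_summable_norm.1 hG ‖q‖) (hF.hasSum_value q) hscaled).congr_fun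
      fun n => by rw [PowerSeries.coeff_mul]

theorem IsEntire.mul (hF : IsEntire F) (hG : IsEntire G) : IsEntire (F * G) :=
  fun q => (hF.hasSum_mul hG q).summable

theorem IsEntire.value_mul (hF : IsEntire F) (hG : IsEntire G) (q : ℍ[ℝ]) :
    value (F * G) q = value (C (value F q) * G) q :=
  (hF.hasSum_mul hG q).tsum_eq

theorem value_C_mul_of_commute {c q : ℍ[ℝ]} (h : Commute c q) :
    value (C c * F) q = c * value F q := by
  simp only [value, PowerSeries.coeff_C_mul, ← tsum_mul_left, ← mul_assoc, (h.pow_right _).eq]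

theorem value_C_mul {c : ℍ[ℝ]} (hc : c ≠ 0) (q : ℍ[ℝ]) :
    value (C c * F) q = c * value F (c⁻¹ * q * c) := by
  have hpow : ∀ n : ℕ, c * (c⁻¹ * q * c) ^ n = q ^ n * c := fun n => by
    rw [GroupWithZero.conj_pow₀ hc, mul_assoc c⁻¹, mul_inv_cancel_left₀ hc]
  simp only [value, PowerSeries.coeff_C_mul, ← tsum_mul_left, ← mul_assoc, hpow]

theorem IsEntire.value_mul_of_commute (hF : IsEntire F) (hG : IsEntire G) {q : ℍ[ℝ]}
    (h : Commute (value F q) q) : value (F * G) q = value F q * value G q :=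
  (hF.value_mul hG q).trans (value_C_mul_of_commute h)

theorem isEntire_of_coeff_eq_zero {N : ℕ} (h : ∀ n ∉ Finset.range N, coeff n F = 0) :
    IsEntire F := fun q =>
  (hasSum_sum_of_ne_finset_zero fun n hn => by rw [h n hn, mul_zero]).summable

theorem value_eq_sum_range {N : ℕ} (h : ∀ n ∉ Finset.range N, coeff n F = 0) (q : ℍ[ℝ]) :
    value F q = ∑ n ∈ Finset.range N, q ^ n * coeff n F :=
  tsum_eq_sum fun n hn => by rw [h n hn, mul_zero]

theorem isEntire_X_pow (k : ℕ) : IsEntire (X ^ k) :=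
  isEntire_of_coeff_eq_zero (N := k + 1) fun n hn => by
    rw [PowerSeries.coeff_X_pow, if_neg (by simp at hn; omega)]

theorem value_X_pow (k : ℕ) (q : ℍ[ℝ]) : value (X ^ k) q = q ^ k := by
  simp [value, PowerSeries.coeff_X_pow]

theorem IsEntire.value_X_pow_mul (hF : IsEntire F) (k : ℕ) (q : ℍ[ℝ]) :
    value (X ^ k * F) q = q ^ k * value F q := by
  rw [(isEntire_X_pow k).value_mul_of_commute hF (by rw [value_X_pow]; exact .pow_self q k),
    value_X_pow]

theorem IsEntire.of_X_pow_mul {k : ℕ} (h : IsEntire (X ^ k * F)) : IsEntire F := fun q => by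
  rcases eq_or_ne q 0 with rfl | hq
  · exact (hasSum_single 0 fun n hn => by rw [zero_pow hn, zero_mul]).summable
  · have hshift := (summable_nat_add_iff k).2 (h q)
    simp only [PowerSeries.coeff_X_pow_mul, pow_add, mul_assoc, ← pow_mul_comm q k] at hshift
    exact (summable_mul_left_iff (pow_ne_zero k hq)).1 hshift

theorem conj_conj (F : PowerSeries ℍ[ℝ]) : conj (conj F) = F := by
  ext1 n
  simp only [conj, PowerSeries.coeff_mk, star_star]

theorem conj_mul (F G : PowerSeries ℍ[ℝ]) : conj (F * G) = conj G * conj F := by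
  ext1 n
  simp only [conj, PowerSeries.coeff_mk, PowerSeries.coeff_mul, star_sum, star_mul]
  exact Finset.Nat.sum_antidiagonal_swap (f := fun p => star (coeff p.1 G) * star (coeff p.2 F))

theorem conj_symmetrization (F : PowerSeries ℍ[ℝ]) :
    conj (symmetrization F) = symmetrization F := by
  rw [symmetrization, conj_mul, conj_conj]

protected theorem IsEntire.symmetrization (hF : IsEntire F) : IsEntire (symmetrization F) :=
  hF.mul hF.conj

end EntirePowerSeries

section Slices

variable (I : imaginaryUnits)

theorem mem_imaginaryUnits_iff {q : ℍ[ℝ]} : q ∈ imaginaryUnits ↔ q.re = 0 ∧ ‖q‖ = 1 := by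
  rw [imaginaryUnits, Set.mem_ofPred_eq]
  constructor
  · intro h
    have hnorm : ‖q‖ = 1 := by
      rw [← pow_eq_one_iff_of_nonneg (norm_nonneg q) two_ne_zero, ← norm_pow, h, norm_neg, norm_one]
    refine ⟨?_, hnorm⟩
    rw [← Quaternion.sq_eq_neg_normSq, h, Quaternion.normSq_eq_norm_mul_self, hnorm]
    simp
  · rintro ⟨hre, hnorm⟩
    rw [Quaternion.sq_eq_neg_normSq.2 hre, Quaternion.normSq_eq_norm_mul_self, hnorm]
    simp

theorem mem_imaginaryUnits_of_sum_sq_eq_one {q : ℍ[ℝ]} (hre : q.re = 0)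
    (him : q.imI ^ 2 + q.imJ ^ 2 + q.imK ^ 2 = 1) : q ∈ imaginaryUnits := by
  have hnormSq : Quaternion.normSq q = 1 := by
    rw [Quaternion.normSq_def', hre]
    linear_combination him
  rw [imaginaryUnits, Set.mem_ofPred_eq, Quaternion.sq_eq_neg_normSq.2 hre, hnormSq,
    Quaternion.coe_one]

theorem star_imaginaryUnit : star (I : ℍ[ℝ]) = -I :=
  Quaternion.star_eq_neg.2 (mem_imaginaryUnits_iff.1 I.2).1

/-- The parametrization `slice I` of `L_I`, as a homomorphism of real algebras. -/
def sliceHom : ℂ →ₐ[ℝ] ℍ[ℝ] :=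
  Complex.liftAux (I : ℍ[ℝ]) ((sq (I : ℍ[ℝ])).symm.trans I.2)

theorem sliceHom_eq_add (z : ℂ) : sliceHom I z = z.re + z.im * (I : ℍ[ℝ]) := by
  simp [sliceHom, Complex.liftAux_apply, Quaternion.coe_mul_eq_smul]

theorem sliceHom_apply (z : ℂ) : sliceHom I z = slice I z :=
  sliceHom_eq_add I z

theorem sliceHom_ofReal (x : ℝ) : sliceHom I x = x :=
  (sliceHom I).commutes x

theorem sliceHom_I : sliceHom I Complex.I = I := by
  simp [sliceHom_eq_add]

theorem star_sliceHom (z : ℂ) : star (sliceHom I z) = sliceHom I (starRingEnd ℂ z) := by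
  simp [sliceHom_eq_add, star_imaginaryUnit, ← Quaternion.coe_commutes]

theorem norm_sliceHom (z : ℂ) : ‖sliceHom I z‖ = ‖z‖ := by
  have hnormSq : ((Quaternion.normSq (sliceHom I z) : ℝ) : ℍ[ℝ]) =
        (Complex.normSq z : ℝ) := by
    rw [← Quaternion.self_mul_star, star_sliceHom, ← map_mul (sliceHom I), Complex.mul_conj,
      sliceHom_ofReal]
  rw [← sq_eq_sq₀ (norm_nonneg _) (norm_nonneg _), Complex.sq_norm, sq,
    ← Quaternion.normSq_eq_norm_mul_self]
  exact Quaternion.coe_injective hnormSq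

theorem injective_sliceHom : Function.Injective (sliceHom I) :=
  (sliceHom I).toRingHom.injective

theorem continuous_sliceHom : Continuous (sliceHom I) :=
  (sliceHom I).toLinearMap.continuous_of_finiteDimensional

theorem tendsto_sliceHom_cobounded : Tendsto (sliceHom I) (cobounded ℂ) (cobounded ℍ[ℝ]) := by
  rw [← tendsto_norm_atTop_iff_cobounded]
  simpa only [norm_sliceHom] using tendsto_norm_cobounded_atTop (E := ℂ)

theorem exists_sliceHom_eq (q : ℍ[ℝ]) : ∃ (I : imaginaryUnits) (z : ℂ), sliceHom I z = q := by
  rcases eq_or_ne q.im 0 with him | him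
  · have hI : (⟨0, 1, 0, 0⟩ : ℍ[ℝ]) ∈ imaginaryUnits :=
      mem_imaginaryUnits_of_sum_sq_eq_one rfl (by norm_num)
    exact ⟨⟨_, hI⟩, q.re, by rw [sliceHom_ofReal, ← Quaternion.re_add_im q, him]; simp⟩
  · have hI : ‖q.im‖⁻¹ • q.im ∈ imaginaryUnits :=
      mem_imaginaryUnits_iff.2 ⟨by simp, by simp [norm_smul, him]⟩
    refine ⟨⟨_, hI⟩, ⟨q.re, ‖q.im‖⟩, ?_⟩
    rw [sliceHom_eq_add, Quaternion.coe_mul_eq_smul, smul_inv_smul₀ (norm_ne_zero_iff.2 him),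
      Quaternion.re_add_im]

instance : Nonempty imaginaryUnits :=
  let ⟨I, _⟩ := exists_sliceHom_eq 0
  ⟨I⟩

/-- The complex structure on `ℍ` given by left multiplication by elements of `L_I`. It is not an
instance, since `I` varies. -/
abbrev sliceNormedSpace : NormedSpace ℂ ℍ[ℝ] :=
  { Module.compHom ℍ[ℝ] (sliceHom I).toRingHom with
    norm_smul_le := fun z q => by
      change ‖sliceHom I z * q‖ ≤ ‖z‖ * ‖q‖
      rw [norm_mul, norm_sliceHom] }

/-- Complex differentiability of `g` at `z` for the complex structure `sliceNormedSpace I` on the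
target: the holomorphy, in the coordinate `x + i y` of `L_I`, of functions on `L_I`. -/
def HolomorphicAt (g : ℂ → ℍ[ℝ]) (z : ℂ) : Prop :=
  letI := sliceNormedSpace I
  DifferentiableAt ℂ g z

end Slices

-- `differentiableAt_complex_iff_differentiableAt_real` does not apply to `sliceNormedSpace`: the
-- real structure that it restricts from `ℂ` agrees with that of `ℍ` only propositionally.
theorem differentiableAt_complex_of_fderiv_I {E : Type*} [NormedAddCommGroup E] [NormedSpace ℝ E]
    [NormedSpace ℂ E] [IsScalarTower ℝ ℂ E] {g : ℂ → E} {z : ℂ} (hd : DifferentiableAt ℝ g z)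
    (h : fderiv ℝ g z Complex.I = Complex.I • fderiv ℝ g z 1) : DifferentiableAt ℂ g z := by
  refine (differentiableAt_iff_restrictScalars ℝ hd).2
    ⟨ContinuousLinearMap.toSpanSingleton ℂ (fderiv ℝ g z 1), ?_⟩
  refine ContinuousLinearMap.coe_injective (Complex.basisOneI.ext fun i => ?_)
  fin_cases i <;> simp [h]

section Holomorphic

variable {I : imaginaryUnits} {g g' : ℂ → ℍ[ℝ]} {z : ℂ}

theorem holomorphicAt_of_dbar (hd : DifferentiableAt ℝ g z) (h : dbar I g z = 0) :
    HolomorphicAt I g z := by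
  let _ := sliceNormedSpace I
  have hsmul : ∀ (w : ℂ) (q : ℍ[ℝ]), w • q = sliceHom I w * q := fun _ _ => rfl
  have : IsScalarTower ℝ ℂ ℍ[ℝ] := ⟨fun r w q => by
    rw [hsmul, hsmul, map_smul, smul_mul_assoc]⟩
  refine differentiableAt_complex_of_fderiv_I hd ?_
  have hcr := (smul_eq_zero.1 h).resolve_left one_half_pos.ne'
  rw [hsmul, sliceHom_I, eq_neg_of_add_eq_zero_left hcr, mul_neg, ← mul_assoc, ← sq,
    show (I : ℍ[ℝ]) ^ 2 = -1 from I.2, neg_one_mul, neg_neg]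

theorem HolomorphicAt.comp {u : ℂ → ℂ} (hg : HolomorphicAt I g (u z))
    (hu : DifferentiableAt ℂ u z) : HolomorphicAt I (fun w => g (u w)) z :=
  letI := sliceNormedSpace I
  DifferentiableAt.comp (𝕜 := ℂ) z hg hu

theorem HolomorphicAt.sub_const (hg : HolomorphicAt I g z) (c : ℍ[ℝ]) :
    HolomorphicAt I (fun w => g w - c) z :=
  letI := sliceNormedSpace I
  DifferentiableAt.sub_const (𝕜 := ℂ) hg c

theorem HolomorphicAt.congr (hg : HolomorphicAt I g z) (h : g' =ᶠ[𝓝 z] g) :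
    HolomorphicAt I g' z :=
  letI := sliceNormedSpace I
  DifferentiableAt.congr_of_eventuallyEq (𝕜 := ℂ) hg h

theorem eq_of_holomorphicAt_of_tendsto (hg : ∀ z, HolomorphicAt I g z) {c : ℍ[ℝ]}
    (hc : Tendsto g (cobounded ℂ) (𝓝 c)) (z : ℂ) : g z = c :=
  letI := sliceNormedSpace I
  Differentiable.apply_eq_of_tendsto_cocompact (f := g) hg z
    (Metric.cobounded_eq_cocompact (α := ℂ) ▸ hc)

theorem holomorphicAt_of_punctured {c : ℂ} (hg : ∀ z ≠ c, HolomorphicAt I g z)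
    (hc : ContinuousAt g c) : HolomorphicAt I g c := by
  let _ := sliceNormedSpace I
  refine (Complex.analyticAt_of_differentiable_on_punctured_nhds_of_continuousAt
    (f := g) ?_ hc).differentiableAt
  filter_upwards [self_mem_nhdsWithin] with z hz using hg z hz

theorem exists_hasSum_of_holomorphicAt (hg : ∀ z, HolomorphicAt I g z) :
    ∃ a : ℕ → ℍ[ℝ], ∀ z, HasSum (fun n => sliceHom I z ^ n * a n) (g z) := by
  let _ := sliceNormedSpace I
  refine ⟨fun n => ((n.factorial : ℂ)⁻¹ • iteratedDeriv n g 0), fun z => ?_⟩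
  refine (hasSum_pow_smul_iteratedDeriv (u := g) hg z).congr_fun fun n => ?_
  rw [← map_pow]
  rfl

theorem exists_isEntire_value_eq {h : ℍ[ℝ] → ℍ[ℝ]}
    (hh : ∀ I z, HolomorphicAt I (fun w => h (sliceHom I w)) z) :
    ∃ F, IsEntire F ∧ ∀ q, value F q = h q := by
  choose a ha using fun I => exists_hasSum_of_holomorphicAt (hh I)
  have hreal : ∀ I (x : ℝ), HasSum (fun n => x ^ n • a I n) (h x) := fun I x => by
    simpa only [sliceHom_ofReal, ← Quaternion.coe_pow, Quaternion.coe_mul_eq_smul] using ha I x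
  obtain ⟨I₀⟩ : Nonempty imaginaryUnits := inferInstance
  have hsum : ∀ q, HasSum (fun n => q ^ n * a I₀ n) (h q) := fun q => by
    obtain ⟨I, z, rfl⟩ := exists_sliceHom_eq q
    rw [eq_of_hasSum_pow_smul (hreal I₀) (hreal I)]
    exact ha I z
  refine ⟨PowerSeries.mk (a I₀), fun q => ?_, fun q => ?_⟩
  · simpa only [PowerSeries.coeff_mk] using (hsum q).summable
  · simpa only [value, PowerSeries.coeff_mk] using (hsum q).tsum_eq

end Holomorphic

section Symmetrization

variable {F : PowerSeries ℍ[ℝ]}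

theorem exists_imaginaryUnit_mul_eq_mul (I : imaginaryUnits) (β : ℍ[ℝ]) :
    ∃ J : imaginaryUnits, (J : ℍ[ℝ]) * β = β * I := by
  rcases eq_or_ne β 0 with rfl | hβ
  · exact ⟨I, by rw [mul_zero, zero_mul]⟩
  · have hI : (I : ℍ[ℝ]) ^ 2 = -1 := I.2
    have hJ : (β * I * β⁻¹) ^ 2 = -1 := by
      simpa [hI, hβ] using GroupWithZero.conj_pow₀ (s := 2) (d := (I : ℍ[ℝ])) (inv_ne_zero hβ)
    exact ⟨⟨_, hJ⟩, inv_mul_cancel_right₀ hβ _⟩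

theorem IsEntire.exists_hasSum_slice (hF : IsEntire F) (z : ℂ) :
    ∃ α β : ℍ[ℝ], ∀ I : imaginaryUnits,
      HasSum (fun n => sliceHom I z ^ n * coeff n F) (α + I * β) ∧
      HasSum (fun n => coeff n F * sliceHom I z ^ n) (α + β * I) := by
  have hnorm := isEntire_iff_summable_norm.1 hF ‖z‖
  have hre : Summable fun n => (z ^ n).re • coeff n F := .of_norm_bounded hnorm fun n => by
    rw [norm_smul, ← norm_pow]
    gcongr
    exact Complex.abs_re_le_norm _
  have him : Summable fun n => (z ^ n).im • coeff n F := .of_norm_bounded hnorm fun n => by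
    rw [norm_smul, ← norm_pow]
    gcongr
    exact Complex.abs_im_le_norm _
  refine ⟨_, _, fun I => ⟨(hre.hasSum.add (him.hasSum.mul_left (I : ℍ[ℝ]))).congr_fun fun n => ?_,
    (hre.hasSum.add (him.hasSum.mul_right (I : ℍ[ℝ]))).congr_fun fun n => ?_⟩⟩ <;>
  rw [← map_pow, sliceHom_eq_add]
  · rw [add_mul, mul_assoc, Quaternion.coe_mul_eq_smul, Quaternion.coe_mul_eq_smul, mul_smul_comm]
  · rw [mul_add, Quaternion.mul_coe_eq_smul, Quaternion.coe_mul_eq_smul, mul_smul_comm,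
      smul_mul_assoc]

theorem IsEntire.exists_norm_value_conj_eq (hF : IsEntire F) (q : ℍ[ℝ]) :
    ∃ p : ℍ[ℝ], ‖p‖ = ‖q‖ ∧ ‖value (conj F) q‖ = ‖value F p‖ := by
  obtain ⟨I, z, rfl⟩ := exists_sliceHom_eq q
  obtain ⟨α, β, hsum⟩ := hF.exists_hasSum_slice (starRingEnd ℂ z)
  obtain ⟨J, hJ⟩ := exists_imaginaryUnit_mul_eq_mul I β
  have hconj : value (conj F) (sliceHom I z) = star (α + β * I) := by
    refine ((hsum I).2.star.congr_fun fun n => ?_).tsum_eq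
    rw [conj, PowerSeries.coeff_mk, star_mul, star_pow, star_sliceHom, Complex.conj_conj]
  refine ⟨sliceHom J (starRingEnd ℂ z), ?_, ?_⟩
  · rw [norm_sliceHom, norm_sliceHom, Complex.norm_conj]
  · rw [hconj, norm_star, value, (hsum J).1.tsum_eq, hJ]

theorem IsEntire.exists_norm_value_symmetrization_eq (hF : IsEntire F) (q : ℍ[ℝ]) :
    ∃ p : ℍ[ℝ], ‖p‖ = ‖q‖ ∧ ‖value (symmetrization F) q‖ = ‖value F q‖ * ‖value F p‖ := by
  rw [symmetrization, hF.value_mul hF.conj]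
  rcases eq_or_ne (value F q) 0 with hq | hq
  · exact ⟨q, rfl, by rw [value_C_mul_of_commute (hq ▸ .zero_left q), norm_mul, hq]; simp⟩
  · obtain ⟨p, hp, hnorm⟩ := hF.exists_norm_value_conj_eq ((value F q)⁻¹ * q * value F q)
    refine ⟨p, ?_, by rw [value_C_mul hq, norm_mul, hnorm]⟩
    rw [hp, norm_mul, norm_mul, norm_inv, mul_right_comm, inv_mul_cancel₀ (norm_ne_zero_iff.2 hq),
      one_mul]

theorem IsEntire.norm_value_symmetrization_coe (hF : IsEntire F) (x : ℝ) :
    ‖value (symmetrization F) x‖ = ‖value F x‖ ^ 2 := by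
  have hconj : value (conj F) x = star (value F x) := by
    refine ((hF.hasSum_value x).star.congr_fun fun n => ?_).tsum_eq
    rw [conj, PowerSeries.coeff_mk, star_mul, star_pow, Quaternion.star_coe,
      ← Quaternion.coe_pow, Quaternion.coe_commutes]
  rw [symmetrization, hF.value_mul_of_commute hF.conj (Quaternion.coe_commute x _).symm, hconj,
    norm_mul, norm_star, sq]

theorem IsEntire.exists_differentiable_sliceHom_eq_value (hF : IsEntire F) (hconj : conj F = F) :
    ∃ φ : ℂ → ℂ, Differentiable ℂ φ ∧ ∀ I z, sliceHom I (φ z) = value F (sliceHom I z) := by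
  have hreal : ∀ n, ((coeff n F).re : ℍ[ℝ]) = coeff n F := fun n => by
    refine (Quaternion.star_eq_self.1 ?_).symm
    simpa only [conj, PowerSeries.coeff_mk] using congrArg (coeff n) hconj
  have hsummable : ∀ z : ℂ, Summable fun n => z ^ n • ((coeff n F).re : ℂ) := fun z =>
    .of_norm_bounded (isEntire_iff_summable_norm.1 hF ‖z‖) fun n => by
      rw [norm_smul, norm_pow, Complex.norm_real, ← Quaternion.norm_coe, hreal]
  refine ⟨_, differentiable_of_hasSum_pow_smul fun z => (hsummable z).hasSum, fun I z => ?_⟩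
  refine ((hsummable z).hasSum.map (sliceHom I) (continuous_sliceHom I)).unique
    ((hF.hasSum_value _).congr_fun fun n => ?_)
  rw [Function.comp_apply, smul_eq_mul, map_mul, map_pow, sliceHom_ofReal, hreal]

end Symmetrization

section Rigidity

variable {F : PowerSeries ℍ[ℝ]}

theorem IsEntire.coeff_eq_zero_of_norm_value_le (hF : IsEntire F) {c : ℝ} {m n : ℕ}
    (hO : ∀ᶠ q in cobounded ℍ[ℝ], ‖value F q‖ ≤ c * ‖q‖ ^ m) (hmn : m < n) : coeff n F = 0 := by
  obtain ⟨I⟩ : Nonempty imaginaryUnits := inferInstance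
  let _ := sliceNormedSpace I
  refine coeff_eq_zero_of_isBigO_pow (a := fun n => coeff n F)
    (u := fun z => value F (sliceHom I z)) (m := m) (fun z => ?_) (.of_bound c ?_) hmn
  · refine (hF.hasSum_value _).congr_fun fun n => ?_
    rw [← map_pow]
    rfl
  · filter_upwards [(tendsto_sliceHom_cobounded I).eventually hO] with z hz
    rwa [norm_pow, ← norm_sliceHom I]

theorem IsEntire.value_symmetrization_ne_zero (hF : IsEntire F) (hne : ∀ q, value F q ≠ 0)
    (q : ℍ[ℝ]) : value (symmetrization F) q ≠ 0 := by
  obtain ⟨p, -, hp⟩ := hF.exists_norm_value_symmetrization_eq q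
  exact norm_ne_zero_iff.1 <|
    hp ▸ mul_ne_zero (norm_ne_zero_iff.2 (hne q)) (norm_ne_zero_iff.2 (hne p))

theorem IsEntire.one_le_norm_value_symmetrization (hF : IsEntire F) {k : ℕ}
    (hk : ∀ᶠ q in cobounded ℍ[ℝ], 1 ≤ ‖q‖ ^ k * ‖value F q‖) :
    ∀ᶠ q in cobounded ℍ[ℝ], 1 ≤ ‖q‖ ^ (2 * k) * ‖value (symmetrization F) q‖ := by
  obtain ⟨R, -, hR⟩ := hasBasis_cobounded_norm.eventually_iff.1 hk
  refine hasBasis_cobounded_norm.eventually_iff.2 ⟨R, trivial, fun q hq => ?_⟩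
  obtain ⟨p, hp, hnorm⟩ := hF.exists_norm_value_symmetrization_eq q
  calc 1 ≤ ‖q‖ ^ k * ‖value F q‖ * (‖p‖ ^ k * ‖value F p‖) :=
        one_le_mul_of_one_le_of_one_le (hR hq) (hR (hp.symm ▸ hq : R ≤ ‖p‖))
    _ = ‖q‖ ^ (2 * k) * ‖value (symmetrization F) q‖ := by rw [hnorm, hp]; ring

theorem IsEntire.exists_norm_value_symmetrization_eq_const (hF : IsEntire F)
    (hne : ∀ q, value F q ≠ 0) {k : ℕ}
    (hk : ∀ᶠ q in cobounded ℍ[ℝ], 1 ≤ ‖q‖ ^ k * ‖value F q‖) :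
    ∃ c, ∀ q, ‖value (symmetrization F) q‖ = c := by
  obtain ⟨φ, hφ, hφ_eq⟩ :=
    hF.symmetrization.exists_differentiable_sliceHom_eq_value (conj_symmetrization F)
  have hφ_norm : ∀ I z, ‖φ z‖ = ‖value (symmetrization F) (sliceHom I z)‖ := fun I z => by
    rw [← hφ_eq, norm_sliceHom]
  obtain ⟨I⟩ : Nonempty imaginaryUnits := inferInstance
  have hφ_ne : ∀ z, φ z ≠ 0 := fun z => by
    rw [← norm_ne_zero_iff, hφ_norm I, norm_ne_zero_iff]
    exact hF.value_symmetrization_ne_zero hne _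
  have hφ_inv : φ⁻¹ =O[cobounded ℂ] (· ^ (2 * k)) := by
    refine .of_bound 1 ?_
    filter_upwards [(tendsto_sliceHom_cobounded I).eventually
      (hF.one_le_norm_value_symmetrization hk)] with z hz
    rw [← hφ_norm, norm_sliceHom] at hz
    rwa [Pi.inv_apply, norm_inv, one_mul, norm_pow,
      inv_le_iff_one_le_mul₀ (norm_pos_iff.2 (hφ_ne z))]
  obtain ⟨c, hc⟩ := exists_eq_const_of_isBigO_pow_of_ne_zero (hφ.inv hφ_ne) hφ_inv
    fun z => inv_ne_zero (hφ_ne z)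
  refine ⟨‖c⁻¹‖, fun q => ?_⟩
  obtain ⟨J, z, rfl⟩ := exists_sliceHom_eq q
  rw [← hφ_norm, ← hc z, Pi.inv_apply, inv_inv]

theorem eq_C_of_norm_value_coe_le {N : ℕ} (h : ∀ n ∉ Finset.range N, coeff n F = 0) {c : ℝ}
    (hc : ∀ x : ℝ, ‖value F x‖ ≤ c) : F = C (coeff 0 F) := by
  have htrunc : (F.trunc N : PowerSeries ℍ[ℝ]) = F := by
    ext1 n
    rw [Polynomial.coeff_coe, PowerSeries.coeff_trunc]
    split_ifs with hn
    · rfl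
    · exact (h n (by simpa using hn)).symm
  have heval : ∀ x : ℝ, (F.trunc N).eval (x : ℍ[ℝ]) = value F x := fun x => by
    rw [value_eq_sum_range h, Polynomial.eval, PowerSeries.eval₂_trunc_eq_sum_range]
    exact Finset.sum_congr rfl fun n _ => by
      rw [RingHom.id_apply, ← Quaternion.coe_pow, Quaternion.coe_commutes]
  have hdeg : (F.trunc N).degree ≤ 0 := by
    by_contra! hpos
    have : IsAbsoluteValue (norm : ℍ[ℝ] → ℝ) := NormMulClass.isAbsoluteValue_norm
    have hlim := (F.trunc N).tendsto_norm_atTop hpos (l := atTop) (z := fun x : ℝ => (x : ℍ[ℝ]))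
      (by simpa only [Quaternion.norm_coe] using tendsto_norm_atTop_atTop)
    obtain ⟨x, hx⟩ := (hlim.eventually_gt_atTop c).exists
    exact (hx.trans_eq (congrArg norm (heval x))).not_ge (hc x)
  rw [← htrunc, Polynomial.eq_C_of_degree_le_zero hdeg]
  simp

theorem IsEntire.eq_C_of_value_ne_zero (hF : IsEntire F)
    (hne : ∀ q, value F q ≠ 0) {k : ℕ}
    (hk : ∀ᶠ q in cobounded ℍ[ℝ], 1 ≤ ‖q‖ ^ k * ‖value F q‖) : F = C (coeff 0 F) := by
  obtain ⟨c, hc⟩ := hF.exists_norm_value_symmetrization_eq_const hne hk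
  have hgrowth : ∀ᶠ q in cobounded ℍ[ℝ], ‖value F q‖ ≤ c * ‖q‖ ^ k := by
    obtain ⟨R, -, hR⟩ := hasBasis_cobounded_norm.eventually_iff.1 hk
    refine hasBasis_cobounded_norm.eventually_iff.2 ⟨R, trivial, fun q hq => ?_⟩
    obtain ⟨p, hp, hnorm⟩ := hF.exists_norm_value_symmetrization_eq q
    calc ‖value F q‖ ≤ ‖value F q‖ * (‖p‖ ^ k * ‖value F p‖) :=
          le_mul_of_one_le_right (norm_nonneg _) (hR (hp.symm ▸ hq : R ≤ ‖p‖))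
      _ = c * ‖q‖ ^ k := by rw [← hc q, hnorm, hp]; ring
  refine eq_C_of_norm_value_coe_le (N := k + 1) (c := √c) (fun n hn => ?_) fun x => ?_
  · exact hF.coeff_eq_zero_of_norm_value_le hgrowth (by simpa using hn)
  · exact Real.le_sqrt_of_sq_le (by rw [← hF.norm_value_symmetrization_coe, hc])

end Rigidity

section Affine

variable {F : PowerSeries ℍ[ℝ]}

theorem value_zero (F : PowerSeries ℍ[ℝ]) : value F 0 = coeff 0 F := by
  rw [value, tsum_eq_single 0 fun n hn => by rw [zero_pow hn, zero_mul], pow_zero, one_mul]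

theorem value_C (c q : ℍ[ℝ]) : value (C c) q = c := by
  rw [value, tsum_eq_single 0 fun n hn => by rw [PowerSeries.coeff_C, if_neg hn, mul_zero],
    PowerSeries.coeff_zero_C, pow_zero, one_mul]

theorem IsEntire.exists_value_eq_pow_mul (hF : IsEntire F)
    (ht : Tendsto (value F) (cobounded ℍ[ℝ]) (cobounded ℍ[ℝ])) (hne : ∀ q ≠ 0, value F q ≠ 0) :
    ∃ (k : ℕ) (b : ℍ[ℝ]), ∀ q, value F q = q ^ k * b := by
  obtain ⟨k, G, hFG, hG₀⟩ : ∃ k G, F = X ^ k * G ∧ coeff 0 G ≠ 0 := by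
    have hF₀ : F ≠ 0 := by
      rintro rfl
      exact hne 1 one_ne_zero (by simp [value])
    refine ⟨_, _, F.X_pow_order_mul_divXPowOrder.symm, ?_⟩
    rwa [PowerSeries.coeff_zero_eq_constantCoeff_apply, Ne,
      PowerSeries.constantCoeff_divXPowOrder_eq_zero_iff]
  have hG : IsEntire G := .of_X_pow_mul (hFG ▸ hF)
  have hFG_value : ∀ q, value F q = q ^ k * value G q := hFG ▸ hG.value_X_pow_mul k
  have hG_ne : ∀ q, value G q ≠ 0 := fun q => by
    rcases eq_or_ne q 0 with rfl | hq
    · rwa [value_zero]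
    · exact right_ne_zero_of_mul (hFG_value q ▸ hne q hq)
  have hG_lower : ∀ᶠ q in cobounded ℍ[ℝ], 1 ≤ ‖q‖ ^ k * ‖value G q‖ := by
    filter_upwards [(tendsto_norm_atTop_iff_cobounded.2 ht).eventually_ge_atTop 1] with q hq
    rwa [hFG_value, norm_mul, norm_pow] at hq
  exact ⟨k, coeff 0 G, fun q => by
    rw [hFG_value, hG.eq_C_of_value_ne_zero hG_ne hG_lower, value_C, PowerSeries.coeff_zero_C]⟩

theorem eq_one_of_injective_pow_mul {k : ℕ} {b : ℍ[ℝ]}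
    (h : Function.Injective fun q : ℍ[ℝ] => q ^ k * b) : k = 1 := by
  have hk : k ≠ 0 := by
    rintro rfl
    exact zero_ne_one (h (by simp only [pow_zero]))
  obtain ⟨I⟩ : Nonempty imaginaryUnits := inferInstance
  have hζ := Complex.isPrimitiveRoot_exp k hk
  have hζ_eq_one : sliceHom I (Complex.exp (2 * Real.pi * Complex.I / k)) = sliceHom I 1 :=
    h (by simp only [← map_pow, hζ.pow_eq_one, one_pow])
  rw [hζ.eq_orderOf, injective_sliceHom I hζ_eq_one, orderOf_one]

theorem exists_eq_mul_add_of_injective {h : ℍ[ℝ] → ℍ[ℝ]}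
    (hh : ∀ I z, HolomorphicAt I (fun w => h (sliceHom I w)) z) (hinj : Function.Injective h)
    (ht : Tendsto h (cobounded ℍ[ℝ]) (cobounded ℍ[ℝ])) :
    ∃ a b : ℍ[ℝ], a ≠ 0 ∧ ∀ q, h q = q * a + b := by
  obtain ⟨F, hF, hF_eq⟩ := exists_isEntire_value_eq (h := fun q => h q - h 0)
    fun I z => (hh I z).sub_const (h 0)
  have hF_tendsto : Tendsto (value F) (cobounded ℍ[ℝ]) (cobounded ℍ[ℝ]) := by
    simpa only [funext hF_eq, sub_eq_add_neg, Function.comp_def] using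
      (tendsto_add_const_cobounded (-h 0)).comp ht
  obtain ⟨k, a, ha⟩ := hF.exists_value_eq_pow_mul hF_tendsto fun q hq => by
    rwa [hF_eq, sub_ne_zero, hinj.ne_iff]
  have heq : ∀ q, h q = q ^ k * a + h 0 := fun q => by rw [← ha, hF_eq, sub_add_cancel]
  obtain rfl : k = 1 := eq_one_of_injective_pow_mul (b := a) fun p q hpq =>
    hinj ((heq p).trans ((congrArg (· + h 0) hpq).trans (heq q).symm))
  refine ⟨a, h 0, ?_, fun q => by rw [heq, pow_one]⟩
  rintro rfl
  exact one_ne_zero (hinj ((heq 1).trans (by rw [mul_zero, zero_add])))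

end Affine

section Compactification

theorem tendsto_coe_nhds_coe_iff {α Y : Type*} [TopologicalSpace Y] {l : Filter α} {u : α → Y}
    {y : Y} : Tendsto (fun a => (u a : OnePoint Y)) l (𝓝 y) ↔ Tendsto u l (𝓝 y) :=
  OnePoint.isOpenEmbedding_coe.tendsto_nhds_iff.symm

theorem coclosedCompact_eq_cobounded {Y : Type*} [PseudoMetricSpace Y] [ProperSpace Y] :
    coclosedCompact Y = cobounded Y := by
  rw [coclosedCompact_eq_cocompact, Metric.cobounded_eq_cocompact]

theorem tendsto_coe_nhds_infty_iff {α Y : Type*} [PseudoMetricSpace Y] [ProperSpace Y]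
    {l : Filter α} {u : α → Y} :
    Tendsto (fun a => (u a : OnePoint Y)) l (𝓝 infty) ↔ Tendsto u l (cobounded Y) := by
  rw [← coclosedCompact_eq_cobounded, ← OnePoint.comap_coe_nhds_infty, tendsto_comap_iff]
  rfl

theorem tendsto_coe_cobounded_of_continuous {Y Z : Type*} [PseudoMetricSpace Y] [ProperSpace Y]
    [TopologicalSpace Z] {f : OnePoint Y → Z} (hf : Continuous f) :
    Tendsto (fun y : Y => f y) (cobounded Y) (𝓝 (f infty)) :=
  (hf.tendsto infty).comp (tendsto_coe_nhds_infty_iff.2 tendsto_id)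

open Classical in
/-- The transformation `q ↦ q⁻¹ + x` of the one-point compactification of a division ring, which
moves `∞` to `x` and `0` to `∞`. -/
def invAdd {K : Type*} [DivisionRing K] (x : K) (p : OnePoint K) : OnePoint K :=
  p.elim ↑x fun q => if q = 0 then infty else ↑(q⁻¹ + x)

section Algebra

variable {K : Type*} [DivisionRing K]

theorem invAdd_zero (x : K) : invAdd x (0 : K) = infty :=
  if_pos rfl

theorem invAdd_coe (x : K) {q : K} (hq : q ≠ 0) : invAdd x q = ↑(q⁻¹ + x) :=
  if_neg hq

theorem invAdd_inv_sub {x q : K} (hq : q ≠ x) : invAdd x ↑(q - x)⁻¹ = q := by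
  rw [invAdd_coe x (inv_ne_zero (sub_ne_zero.2 hq)), inv_inv, sub_add_cancel]

theorem invAdd_coe_injective (x : K) : Function.Injective fun q : K => invAdd x q := by
  intro p q h
  simp only [invAdd, OnePoint.elim_some] at h
  split_ifs at h with hp hq hq
  · exact hp.trans hq.symm
  · exact absurd h (OnePoint.infty_ne_coe _)
  · exact absurd h (OnePoint.coe_ne_infty _)
  · exact inv_injective (add_right_cancel (OnePoint.coe_injective h))

theorem invAdd_coe_ne (x q : K) : invAdd x q ≠ x := by
  rcases eq_or_ne q 0 with rfl | hq
  · exact (invAdd_zero x).trans_ne (OnePoint.infty_ne_coe x)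
  · rw [invAdd_coe x hq, Ne, OnePoint.coe_eq_coe, add_eq_right]
    exact inv_ne_zero hq

theorem invAdd_injective (x : K) : Function.Injective (invAdd x) := by
  intro p q h
  induction p using OnePoint.rec <;> induction q using OnePoint.rec
  · rfl
  · exact absurd h.symm (invAdd_coe_ne x _)
  · exact absurd h (invAdd_coe_ne x _)
  · exact congrArg _ (invAdd_coe_injective x h)

end Algebra

theorem continuous_invAdd {K : Type*} [NormedDivisionRing K] [ProperSpace K] (x : K) :
    Continuous (invAdd x) := by
  have hinv : ∀ {q : K}, q ≠ 0 → invAdd x q = ↑(q⁻¹ + x) := invAdd_coe x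
  refine (OnePoint.continuous_iff _).2 ⟨?_, continuous_iff_continuousAt.2 fun q => ?_⟩
  · have hlim : Tendsto (fun q : K => q⁻¹ + x) (cobounded K) (𝓝 x) := by
      simpa only [zero_add] using (tendsto_inv₀_cobounded (α := K)).add_const x
    rw [coclosedCompact_eq_cobounded]
    refine (tendsto_coe_nhds_coe_iff.2 hlim).congr' ?_
    filter_upwards [eventually_ne_cobounded 0] with q hq using (hinv hq).symm
  · rcases eq_or_ne q 0 with rfl | hq
    · have hlim : Tendsto (fun q : K => q⁻¹ + x) (𝓝[≠] 0) (cobounded K) :=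
        (tendsto_add_const_cobounded x).comp tendsto_inv₀_nhdsNE_zero
      rw [continuousAt_iff_punctured_nhds, invAdd_zero]
      refine (tendsto_coe_nhds_infty_iff.2 hlim).congr' ?_
      filter_upwards [self_mem_nhdsWithin] with q hq using (hinv hq).symm
    · refine (OnePoint.continuous_coe.continuousAt.comp
        ((continuousAt_inv₀ hq).add_const x)).congr ?_
      filter_upwards [eventually_ne_nhds hq] with p hp using (hinv hp).symm

end Compactification

section Extended

variable {f : HHat → HHat}

theorem IsSemiregular.holomorphicAt {f : ℍ[ℝ] → HHat} (hf : IsSemiregular f) {I : imaginaryUnits}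
    {g : ℂ → ℍ[ℝ]} {z : ℂ} (hg : ∀ᶠ w in 𝓝 z, f (sliceHom I w) = g w) : HolomorphicAt I g z := by
  simp only [sliceHom_apply] at hg
  rcases hf I I.2 z with ⟨R, hR, k, hfk, hd, hdbar⟩ | ⟨hpole, -⟩
  · have hball : Metric.ball z R ∈ 𝓝 z := Metric.ball_mem_nhds z hR
    refine (holomorphicAt_of_dbar (hd.differentiableAt hball)
      (hdbar z (Metric.mem_ball_self hR))).congr ?_
    filter_upwards [hball, hg] with w hw hgw
    exact OnePoint.coe_injective (hgw.symm.trans (hfk w hw))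
  · exact absurd (hg.self_of_nhds.symm.trans hpole) (OnePoint.coe_ne_infty _)

theorem exists_coe_eq_of_map_infty {Y Z : Type*} {f : OnePoint Y → OnePoint Z}
    (hinj : Function.Injective f) (hinf : f infty = infty) : ∃ h : Y → Z, ∀ y : Y, f y = h y := by
  choose h hh using fun y : Y => OnePoint.ne_infty_iff_exists.1
    (hinf ▸ hinj.ne (OnePoint.coe_ne_infty y))
  exact ⟨h, fun y => (hh y).symm⟩

theorem isRegularAffine_of_holomorphicAt (hcont : Continuous f) (hinj : Function.Injective f)
    (hinf : f infty = infty) {h : ℍ[ℝ] → ℍ[ℝ]} (hfh : ∀ q : ℍ[ℝ], f q = h q)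
    (hhol : ∀ I, ∀ z ≠ 0, HolomorphicAt I (fun w => h (sliceHom I w)) z) :
    IsRegularAffine f := by
  have h_cont : Continuous h := by
    refine OnePoint.isOpenEmbedding_coe.isEmbedding.continuous_iff.2 ?_
    exact (hcont.comp OnePoint.continuous_coe).congr hfh
  have h_inj : Function.Injective h := fun p q hpq =>
    OnePoint.coe_injective (hinj (by rw [hfh, hfh, hpq]))
  have h_tendsto : Tendsto h (cobounded ℍ[ℝ]) (cobounded ℍ[ℝ]) := by
    rw [← tendsto_coe_nhds_infty_iff, ← hinf]
    simpa only [hfh] using tendsto_coe_cobounded_of_continuous hcont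
  have h_hol : ∀ I z, HolomorphicAt I (fun w => h (sliceHom I w)) z := fun I z => by
    rcases eq_or_ne z 0 with rfl | hz
    · exact holomorphicAt_of_punctured (hhol I)
        (h_cont.comp (continuous_sliceHom I)).continuousAt
    · exact hhol I z hz
  obtain ⟨a, b, ha, hab⟩ := exists_eq_mul_add_of_injective h_hol h_inj h_tendsto
  exact ⟨hinf, a, b, ha, fun q => by rw [hfh, hab]⟩

theorem exists_pole_on_slice (hcont : Continuous f) (hinj : Function.Injective f)
    (hsemi : IsSemiregular fun q : ℍ[ℝ] => f q) (hinf : f infty ≠ infty) (I : imaginaryUnits) :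
    ∃ z, f (sliceHom I z) = infty := by
  by_contra! hfin
  choose g hg using fun z => OnePoint.ne_infty_iff_exists.1 (hfin z)
  obtain ⟨b, hb⟩ := OnePoint.ne_infty_iff_exists.1 hinf
  have hlim : Tendsto g (cobounded ℂ) (𝓝 b) := by
    rw [← tendsto_coe_nhds_coe_iff, hb]
    exact ((tendsto_coe_cobounded_of_continuous hcont).comp (tendsto_sliceHom_cobounded I)).congr
      fun z => (hg z).symm
  have hconst : g 0 = b := eq_of_holomorphicAt_of_tendsto
    (fun z => hsemi.holomorphicAt (.of_forall fun w => (hg w).symm)) hlim 0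
  exact OnePoint.coe_ne_infty _ (hinj ((hg 0).symm.trans (hconst ▸ hb)))

theorem exists_real_pole (hcont : Continuous f) (hinj : Function.Injective f)
    (hsemi : IsSemiregular fun q : ℍ[ℝ] => f q) (hinf : f infty ≠ infty) :
    ∃ x : ℝ, f (x : ℍ[ℝ]) = infty := by
  obtain ⟨I, hI⟩ : ∃ I : imaginaryUnits, (I : ℍ[ℝ]).imI = 1 :=
    ⟨⟨⟨0, 1, 0, 0⟩, mem_imaginaryUnits_of_sum_sq_eq_one rfl (by norm_num)⟩, rfl⟩
  obtain ⟨J, hJ⟩ : ∃ J : imaginaryUnits, (J : ℍ[ℝ]).imI = 0 :=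
    ⟨⟨⟨0, 0, 1, 0⟩, mem_imaginaryUnits_of_sum_sq_eq_one rfl (by norm_num)⟩, rfl⟩
  obtain ⟨z, hz⟩ := exists_pole_on_slice hcont hinj hsemi hinf I
  obtain ⟨w, hw⟩ := exists_pole_on_slice hcont hinj hsemi hinf J
  have hzw := OnePoint.coe_injective (hinj (hz.trans hw.symm))
  have him : z.im = 0 := by
    simpa [sliceHom_eq_add, hI, hJ] using congrArg (fun q : ℍ[ℝ] => q.imI) hzw
  refine ⟨z.re, ?_⟩
  rw [← hz, sliceHom_eq_add, him, Quaternion.coe_zero, zero_mul, add_zero]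

theorem exists_eq_inv_mul_add_of_real_pole (hcont : Continuous f) (hinj : Function.Injective f)
    (hsemi : IsSemiregular fun q : ℍ[ℝ] => f q) {x : ℝ} (hx : f (x : ℍ[ℝ]) = infty) :
    ∃ a b : ℍ[ℝ], a ≠ 0 ∧ f infty = b ∧ ∀ q : ℍ[ℝ], q ≠ x → f q = ↑((q - x)⁻¹ * a + b) := by
  have hf_cont := hcont.comp (continuous_invAdd (x : ℍ[ℝ]))
  have hf_inj := hinj.comp (invAdd_injective (x : ℍ[ℝ]))
  obtain ⟨h, hfh⟩ := exists_coe_eq_of_map_infty hf_inj hx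
  have hhol : ∀ I, ∀ z ≠ 0, HolomorphicAt I (fun w => h (sliceHom I w)) z := fun I z hz => by
    have hg : HolomorphicAt I (fun w => h (sliceHom I w - x)⁻¹) (z⁻¹ + x) := by
      refine hsemi.holomorphicAt ?_
      filter_upwards [eventually_ne_nhds (add_ne_right.2 (inv_ne_zero hz))] with w hw
      have hwx : sliceHom I w ≠ x := by
        rwa [← sliceHom_ofReal I, (injective_sliceHom I).ne_iff]
      rw [← hfh, Function.comp_apply, invAdd_inv_sub hwx]
    simpa only [map_add, map_inv₀, sliceHom_ofReal, add_sub_cancel_right, inv_inv] using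
      hg.comp (u := fun w => w⁻¹ + x) ((differentiableAt_inv hz).add_const _)
  obtain ⟨-, a, b, ha, hab⟩ := isRegularAffine_of_holomorphicAt hf_cont hf_inj hx hfh hhol
  refine ⟨a, b, ha, ?_, fun q hq => ?_⟩
  · simpa [invAdd_zero] using hab 0
  · simpa only [Function.comp_apply, invAdd_inv_sub hq] using hab (q - x)⁻¹

end Extended

section Fractional

theorem coeff_linear_eq_zero (c d : ℍ[ℝ]) {n : ℕ} (hn : n ∉ Finset.range 2) :
    coeff n (linear c d) = 0 := by
  rw [Finset.mem_range, not_lt] at hn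
  rw [linear, map_add, PowerSeries.coeff_mul_C, PowerSeries.coeff_X, PowerSeries.coeff_C,
    if_neg (by omega), if_neg (by omega), zero_mul, add_zero]

theorem isEntire_linear (c d : ℍ[ℝ]) : IsEntire (linear c d) :=
  isEntire_of_coeff_eq_zero fun _ => coeff_linear_eq_zero c d

theorem value_linear (c d q : ℍ[ℝ]) : value (linear c d) q = q * c + d := by
  rw [value_eq_sum_range fun _ => coeff_linear_eq_zero c d]
  simp [linear, Finset.sum_range_succ, PowerSeries.coeff_X, PowerSeries.coeff_C, add_comm]

theorem conj_linear (c d : ℍ[ℝ]) : conj (linear c d) = linear (star c) (star d) := by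
  ext1 n
  simp only [conj, linear, PowerSeries.coeff_mk, map_add, PowerSeries.coeff_mul_C,
    PowerSeries.coeff_X, PowerSeries.coeff_C, star_add, star_mul]
  split_ifs <;> simp

theorem value_linear_one_neg_coe_mul (x : ℝ) {G : PowerSeries ℍ[ℝ]} (hG : IsEntire G) (q : ℍ[ℝ]) :
    value (linear 1 (-x) * G) q = (q - x) * value G q := by
  have hvalue : value (linear 1 (-x)) q = q - x := by rw [value_linear, mul_one, sub_eq_add_neg]
  rw [(isEntire_linear 1 (-x)).value_mul_of_commute hG, hvalue]
  rw [hvalue]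
  exact (Commute.refl q).sub_left (Quaternion.coe_commute x q)

theorem conj_linear_one_neg_coe (x : ℝ) :
    conj (linear 1 (-(x : ℍ[ℝ]))) = linear 1 (-(x : ℍ[ℝ])) := by
  rw [conj_linear, star_one, star_neg, Quaternion.star_coe]

theorem value_symmetrization_linear_one_neg_coe (x : ℝ) (q : ℍ[ℝ]) :
    value (symmetrization (linear 1 (-(x : ℍ[ℝ])))) q = (q - x) * (q - x) := by
  rw [symmetrization, conj_linear_one_neg_coe, value_linear_one_neg_coe_mul x (isEntire_linear _ _),
    value_linear, mul_one, sub_eq_add_neg q]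

/-- The matrix of the regular fractional transformation `q ↦ (q - x)⁻¹ a + b`, whose pole `x` is
real. -/
def poleMatrix (x : ℝ) {a : ℍ[ℝ]} (b : ℍ[ℝ]) (ha : a ≠ 0) : (Matrix (Fin 2) (Fin 2) ℍ[ℝ])ˣ where
  val := !![b, 1; a - (x : ℍ[ℝ]) * b, -(x : ℍ[ℝ])]
  inv := !![a⁻¹ * x, a⁻¹; 1 - b * a⁻¹ * x, -(b * a⁻¹)]
  val_inv := by
    rw [Matrix.mul_fin_two, Matrix.one_fin_two]
    congr! <;> simp [sub_mul, mul_sub, mul_assoc, ha, Quaternion.coe_commutes x]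
  inv_val := by
    rw [Matrix.mul_fin_two, Matrix.one_fin_two]
    congr! <;> simp [sub_mul, mul_sub, mul_assoc, ha, Quaternion.coe_commutes x]

variable {x : ℝ} {a b q : ℍ[ℝ]}

theorem mem_fractionalDomain_poleMatrix (ha : a ≠ 0) (hq : q ≠ x) :
    q ∈ fractionalDomain (poleMatrix x b ha) := by
  change value (symmetrization (linear 1 (-(x : ℍ[ℝ])))) q ≠ 0
  rw [value_symmetrization_linear_one_neg_coe]
  exact mul_self_ne_zero.2 (sub_ne_zero.2 hq)

theorem regularFractional_poleMatrix (ha : a ≠ 0) (hq : q ≠ x) :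
    regularFractional (poleMatrix x b ha) q = (q - x)⁻¹ * a + b := by
  have hqx : q - x ≠ 0 := sub_ne_zero.2 hq
  calc regularFractional (poleMatrix x b ha) q
      = (value (symmetrization (linear 1 (-(x : ℍ[ℝ])))) q)⁻¹ *
          value (conj (linear 1 (-(x : ℍ[ℝ]))) * linear b (a - x * b)) q := rfl
    _ = ((q - x) * (q - x))⁻¹ * ((q - x) * (q * b + (a - x * b))) := by
        rw [value_symmetrization_linear_one_neg_coe, conj_linear_one_neg_coe,
          value_linear_one_neg_coe_mul x (isEntire_linear _ _), value_linear]
    _ = (q - x)⁻¹ * (a + (q - x) * b) := by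
        rw [mul_inv_rev, mul_assoc, inv_mul_cancel_left₀ hqx, sub_mul, add_sub_left_comm]
    _ = (q - x)⁻¹ * a + b := by rw [mul_add, inv_mul_cancel_left₀ hqx]

end Fractional

end SliceRegular

end

theorem mainTheorem3 (f : SliceRegular.HHat → SliceRegular.HHat)
    (hcont : Continuous f) (hinj : Function.Injective f)
    (hsemi : SliceRegular.IsSemiregular (fun q : ℍ[ℝ] => f (q : SliceRegular.HHat))) :
    SliceRegular.IsRegularAffine f ∨
      ∃ (x : ℝ) (a b : ℍ[ℝ]) (A : (Matrix (Fin 2) (Fin 2) ℍ[ℝ])ˣ),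
        a ≠ 0 ∧
        A.val = !![b, 1; a - (x : ℍ[ℝ]) * b, -(x : ℍ[ℝ])] ∧
        f ((x : ℍ[ℝ]) : SliceRegular.HHat) = OnePoint.infty ∧
        f OnePoint.infty = (b : SliceRegular.HHat) ∧
        ∀ q : ℍ[ℝ], q ≠ (x : ℍ[ℝ]) →
          q ∈ SliceRegular.fractionalDomain A ∧
          f (q : SliceRegular.HHat) =
            ((SliceRegular.regularFractional A q : ℍ[ℝ]) : SliceRegular.HHat) := by
  by_cases hinf : f OnePoint.infty = OnePoint.infty
  · left
    obtain ⟨h, hfh⟩ := SliceRegular.exists_coe_eq_of_map_infty hinj hinf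
    exact SliceRegular.isRegularAffine_of_holomorphicAt hcont hinj hinf hfh fun I z _ =>
      hsemi.holomorphicAt (.of_forall fun w => hfh (SliceRegular.sliceHom I w))
  · right
    obtain ⟨x, hx⟩ := SliceRegular.exists_real_pole hcont hinj hsemi hinf
    obtain ⟨a, b, ha, hb, hfq⟩ :=
      SliceRegular.exists_eq_inv_mul_add_of_real_pole hcont hinj hsemi hx
    refine ⟨x, a, b, SliceRegular.poleMatrix x b ha, ha, rfl, hx, hb, fun q hq => ⟨?_, ?_⟩⟩
    · exact SliceRegular.mem_fractionalDomain_poleMatrix ha hq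
    · rw [hfq q hq, SliceRegular.regularFractional_poleMatrix ha hq]
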